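/- Let $K$ be a topological space, $\mu$ a Borel measure on $K$, $\mathcal K=L^2_{\mathbb R}(K,\mu)$ with inner product $\cdot$ and norm $\|\cdot\|$, and let $\Omega$ be a (possibly unbounded) positive self-adjoint operator on $\mathcal K$ with trivial kernel. Let $\Omega^{1/2}$ be its positive square root and $\Omega^{-1/2}$ the inverse of $\Omega^{1/2}$. For $\lambda=\pm\frac12$ let $\mathcal K_\lambda$ be the completion of the domain $\mathcal D(\Omega^\lambda)$ in the norm $\|\Omega^\lambda q\|$; $\Omega^\lambda$ extends by continuity to an isometry $\mathcal K_\lambda\to\mathcal K$, and $\Omega$ extends to an isometry $\mathcal K_{1/2}\to\mathcal K_{-1/2}$. For $w\in\mathcal K_\lambda$, $w'\in\mathcal K_{-\lambda}$ write $w\cdot w'=\Omega^\lambda w\cdot\Omega^{-\lambda}w'$. For $A\subseteq K$ let $L^2_{\mathbb R}(A,\mu)\subseteq\mathcal K$ be the subspace of functions that vanish almost everywhere outside $A$. Let $\mathcal S$ be a local structure, that is, a linear subspace of $\mathcal K$ with $\mathcal S\subseteq\mathcal D(\Omega^{1/2})\cap\mathcal D(\Omega^{-1/2})$ such that $\mathcal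 S_A:=\mathcal S\cap L^2_{\mathbb R}(A,\mu)$ is dense in $L^2_{\mathbb R}(A,\mu)$ for every Borel set $A\subseteq K$. For $B\subseteq K$, an element $h\in\mathcal K_{\pm1/2}$ is said to vanish outside $B$ if $\eta\cdot h=0$ for all $\eta\in\mathcal S_{B^c}$, and $\Omega$ is called strongly non-local over $B$ if there is no $h\in\mathcal K_{1/2}$, $h\neq0$, such that both $h$ and $\Omega h$ vanish outside $B$. Put $\mathcal H(B^c,\Omega)=\mathcal S_{B^c}\times\mathcal S_{B^c}\subseteq\mathcal K_{1/2}\oplus\mathcal K_{-1/2}$ and, for $(q,p)\in\mathcal K_{1/2}\oplus\mathcal K_{-1/2}$, $$z_\Omega(q,p)=\tfrac1{\sqrt2}\left(\Omega^{1/2}q+i\,\Omega^{-1/2}p\right)\in\mathcal K^{\mathbb C}=L^2_{\mathbb C}(K,\mu).$$ Then for every subset $B\subseteq K$ the following statements are equivalent: (i) $\Omega$ is strongly non-local over $B$; (ii) the orthogonal complement of $z_\Omega(\mathcal H(B^c,\Omega))$ in $\mathcal K^{\mathbb C}$ is $\{0\}$; (iii) the orthogonal complement of $\overline{\mathrm{span}}_{\mathbb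 C}\,z_\Omega(\mathcal H(B^c,\Omega))$ in $\mathcal K^{\mathbb C}$ is $\{0\}$; (iv) $\mathrm{span}_{\mathbb C}\,z_\Omega(\mathcal H(B^c,\Omega))$ is dense in $\mathcal K^{\mathbb C}$. -/

import Mathlib

open MeasureTheory

noncomputable section

namespace OscillatorField

section HilbertScale

variable {H : Type*} [NormedAddCommGroup H] [InnerProductSpace ℝ H] [CompleteSpace H]

/-- A (possibly unbounded) positive self-adjoint operator on a real Hilbert space. Self-adjointness
includes density of the domain, see `IsSelfAdjoint.dense_domain`. -/
structure IsPositiveSelfAdjoint (A : H →ₗ.[ℝ] H) : Prop where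
  selfAdjoint : IsSelfAdjoint A
  nonneg : ∀ x : A.domain, 0 ≤ inner ℝ (A x) (x : H)

/-- `R` is the positive square root of `A`: it is positive self-adjoint and `R ∘ R = A` as unbounded
operators, i.e. with the natural domain `{x ∈ D(R) | R x ∈ D(R)}` of `R ∘ R`. -/
structure IsPositiveSqrt (R A : H →ₗ.[ℝ] H) : Prop where
  positive : IsPositiveSelfAdjoint R
  sq_eq : ∀ x y : H, (x, y) ∈ A.graph ↔ ∃ w : H, (x, w) ∈ R.graph ∧ (w, y) ∈ R.graph

open Classical in
/-- The operator `Ω^{1/2}`: the unique positive square root of the positive self-adjoint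
operator `Ω` (and a junk value if there is none, which happens only if `Ω` is not positive
self-adjoint). -/
def powHalf (Ω : H →ₗ.[ℝ] H) : H →ₗ.[ℝ] H :=
  if h : ∃ R, IsPositiveSqrt R Ω then h.choose else ⊥

/-- The operator `Ω^{-1/2}`, with domain the range of `Ω^{1/2}`. -/
def powNegHalf (Ω : H →ₗ.[ℝ] H) : H →ₗ.[ℝ] H :=
  (powHalf Ω).inverse

/-- The domain of `T`, to be equipped with the norm `‖T x‖` instead of the norm of `H`. -/
def NormedDomain (T : H →ₗ.[ℝ] H) : Type _ := T.domain

instance (T : H →ₗ.[ℝ] H) : AddCommGroup (NormedDomain T) :=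
  inferInstanceAs (AddCommGroup T.domain)

instance (T : H →ₗ.[ℝ] H) : Module ℝ (NormedDomain T) :=
  inferInstanceAs (Module ℝ T.domain)

/-- The map `x ↦ T x` on `D(T)`. -/
def NormedDomain.apply (T : H →ₗ.[ℝ] H) : NormedDomain T →ₗ[ℝ] H := T.toFun

/-- The norm of `x` is `‖T x‖`. (A norm, and not only a seminorm, as soon as `T` is injective.) -/
instance (T : H →ₗ.[ℝ] H) : SeminormedAddCommGroup (NormedDomain T) :=
  SeminormedAddCommGroup.induced (NormedDomain T) H (NormedDomain.apply T)

instance (T : H →ₗ.[ℝ] H) : NormedSpace ℝ (NormedDomain T) :=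
  NormedSpace.induced ℝ (NormedDomain T) H (NormedDomain.apply T)

/-- `[D(T)]`: the completion of `D(T)` for the norm `‖T x‖`. -/
abbrev CompletedDomain (T : H →ₗ.[ℝ] H) : Type _ :=
  UniformSpace.Completion (NormedDomain T)

/-- The canonical map `D(T) → [D(T)]`. -/
def toCompletedDomain (T : H →ₗ.[ℝ] H) : T.domain →ₗ[ℝ] CompletedDomain T :=
  (UniformSpace.Completion.toComplₗᵢ (𝕜 := ℝ) (E := NormedDomain T)).toLinearMap

/-- The extension by continuity of `T : D(T) → H` to an isometry `[D(T)] → H`. -/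
def extendedApply (T : H →ₗ.[ℝ] H) : CompletedDomain T →L[ℝ] H :=
  LinearMap.extendOfNorm T.toFun (toCompletedDomain T)

/-- The space `𝒦_{1/2} = [D(Ω^{1/2})]`. -/
abbrev KHalf (Ω : H →ₗ.[ℝ] H) : Type _ := CompletedDomain (powHalf Ω)

/-- The space `𝒦_{-1/2} = [D(Ω^{-1/2})]`. -/
abbrev KNegHalf (Ω : H →ₗ.[ℝ] H) : Type _ := CompletedDomain (powNegHalf Ω)

/-- The map `D(Ω^{1/2}) → 𝒦_{-1/2}`, `x ↦ Ω^{1/2} x ∈ ran Ω^{1/2} = D(Ω^{-1/2})`. -/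
def powHalfToKNegHalf (Ω : H →ₗ.[ℝ] H) : (powHalf Ω).domain →ₗ[ℝ] KNegHalf Ω :=
  (toCompletedDomain (powNegHalf Ω)).comp
    ((powHalf Ω).toFun.codRestrict (powNegHalf Ω).domain fun x => by
      rw [powNegHalf, LinearPMap.inverse_domain]
      exact LinearMap.mem_range_self _ x)

/-- The operator `Ω = Ω^{1/2} Ω^{1/2} : 𝒦_{1/2} → 𝒦 → 𝒦_{-1/2}`, both factors being the extensions by
continuity of `Ω^{1/2}`; the second one is an isometry for the norm of `𝒦` on `D(Ω^{1/2})`. -/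
def extendedOmega (Ω : H →ₗ.[ℝ] H) : KHalf Ω →L[ℝ] KNegHalf Ω :=
  (LinearMap.extendOfNorm (powHalfToKNegHalf Ω) (powHalf Ω).domain.subtype).comp
    (extendedApply (powHalf Ω))

/-- The pairing `η · h = ⟨Ω^{1/2} η, Ω^{-1/2} h⟩` of `η ∈ 𝒦_{1/2}` and `h ∈ 𝒦_{-1/2}`. -/
def pairing (Ω : H →ₗ.[ℝ] H) (η : KHalf Ω) (h : KNegHalf Ω) : ℝ :=
  inner ℝ (extendedApply (powHalf Ω) η) (extendedApply (powNegHalf Ω) h)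

/-- The image in `[D(T)]` of the vectors of `V` that belong to `D(T)`. -/
def imageInCompletion (T : H →ₗ.[ℝ] H) (V : Submodule ℝ H) : Submodule ℝ (CompletedDomain T) :=
  (V.comap T.domain.subtype).map (toCompletedDomain T)

end HilbertScale

section LocalStructure

variable {X : Type*} [MeasurableSpace X] {μ : Measure X}

/-- `L²_ℝ(B, μ)` as a subspace of `L²_ℝ(X, μ)`: the functions that vanish almost everywhere
outside `B`. -/
def L2On (μ : Measure X) (B : Set X) : Submodule ℝ (Lp ℝ 2 μ) where
  carrier := {f | ∀ᵐ x ∂μ, x ∉ B → f x = 0}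
  zero_mem' := by
    filter_upwards [Lp.coeFn_zero ℝ 2 μ] with x hx _
    exact hx
  add_mem' {f g} hf hg := by
    filter_upwards [hf, hg, Lp.coeFn_add f g] with x h1 h2 h3 hx
    rw [h3, Pi.add_apply, h1 hx, h2 hx, add_zero]
  smul_mem' c f hf := by
    filter_upwards [hf, Lp.coeFn_smul c f] with x h1 h2 hx
    rw [h2, Pi.smul_apply, h1 hx, smul_zero]

/-- `𝒮_B = 𝒮 ∩ L²_ℝ(B, μ)`. -/
def localPart (S : Submodule ℝ (Lp ℝ 2 μ)) (B : Set X) : Submodule ℝ (Lp ℝ 2 μ) :=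
  S ⊓ L2On μ B

/-- `𝒮` is a local structure for the oscillator field determined by `Ω`. -/
structure IsLocalStructure (Ω : Lp ℝ 2 μ →ₗ.[ℝ] Lp ℝ 2 μ) (S : Submodule ℝ (Lp ℝ 2 μ)) : Prop where
  le_domain : S ≤ (powHalf Ω).domain ⊓ (powNegHalf Ω).domain
  dense_localPart : ∀ B : Set X, MeasurableSet B →
    (localPart S B).topologicalClosure = L2On μ B

variable (Ω : Lp ℝ 2 μ →ₗ.[ℝ] Lp ℝ 2 μ) (S : Submodule ℝ (Lp ℝ 2 μ))

/-- `h ∈ 𝒦_{1/2}` vanishes in `B`: `η · h = 0` for all `η ∈ 𝒮_B`, seen as elements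
of `𝒦_{-1/2}`. -/
def VanishesInHalf (B : Set X) (h : KHalf Ω) : Prop :=
  ∀ η ∈ imageInCompletion (powNegHalf Ω) (localPart S B), pairing Ω h η = 0

/-- `h ∈ 𝒦_{-1/2}` vanishes in `B`: `η · h = 0` for all `η ∈ 𝒮_B`, seen as elements
of `𝒦_{1/2}`. -/
def VanishesInNegHalf (B : Set X) (h : KNegHalf Ω) : Prop :=
  ∀ η ∈ imageInCompletion (powHalf Ω) (localPart S B), pairing Ω η h = 0

/-- `Ω` is strongly non-local on `B`: there is no nonzero `h ∈ 𝒦_{1/2}` such that both `h`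
and `Ω h ∈ 𝒦_{-1/2}` vanish outside `B`. -/
def StronglyNonlocal (B : Set X) : Prop :=
  ¬ ∃ h : KHalf Ω, h ≠ 0 ∧ VanishesInHalf Ω S Bᶜ h ∧ VanishesInNegHalf Ω S Bᶜ (extendedOmega Ω h)

/-- The phase space `ℋ = 𝒦_{1/2} ⊕ 𝒦_{-1/2}` (as a vector space). -/
abbrev PhaseSpace : Type _ := KHalf Ω × KNegHalf Ω

/-- `ℋ(B, Ω) = 𝒮_B × 𝒮_B`, as a subspace of `ℋ`. -/
def localPhaseSpace (B : Set X) : Submodule ℝ (PhaseSpace Ω) :=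
  (imageInCompletion (powHalf Ω) (localPart S B)).prod
    (imageInCompletion (powNegHalf Ω) (localPart S B))

/-- The inclusion of `L²_ℝ(X, μ)` in its complexification `L²_ℂ(X, μ)`. -/
def toComplexL2 (μ : Measure X) : Lp ℝ 2 μ →L[ℝ] Lp ℂ 2 μ :=
  Complex.ofRealCLM.compLpL 2 μ

/-- `z_Ω(q, p) = (Ω^{1/2} q + i Ω^{-1/2} p) / √2`. -/
def zMap (Y : PhaseSpace Ω) : Lp ℂ 2 μ :=
  ((1 / Real.sqrt 2 : ℝ) : ℂ) •
    (toComplexL2 μ (extendedApply (powHalf Ω) Y.1) +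
      Complex.I • toComplexL2 μ (extendedApply (powNegHalf Ω) Y.2))

/-- The orthogonal complement of a subset of a complex Hilbert space. -/
def orthogonalComplement {V : Type*} [NormedAddCommGroup V] [InnerProductSpace ℂ V]
    (M : Set V) : Submodule ℂ V where
  carrier := {v | ∀ w ∈ M, inner ℂ w v = 0}
  zero_mem' w _ := inner_zero_right w
  add_mem' {u v} hu hv w hw := by rw [inner_add_right, hu w hw, hv w hw, add_zero]
  smul_mem' c v hv w hw := by rw [inner_smul_right, hv w hw, mul_zero]

end LocalStructure

end OscillatorField

end

/-! The extension of `Ω^{1/2}` is an isometry of `𝒦_{1/2}` onto `𝒦`, since an injective self-adjoint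
operator has dense range, and `Ω^{-1/2} Ω h = Ω^{1/2} h`. Writing `v = Ω^{1/2} h`, both vanishing
conditions on `h` say that `v` is orthogonal to `Ω^{-1/2} 𝒮_{Bᶜ}` and `Ω^{1/2} 𝒮_{Bᶜ}`
(`stronglyNonlocal_iff`). Since `q` and `p` vary independently, `a + i b` is orthogonal to every
`z_Ω(q, p)` exactly when `a` and `b` each satisfy that same condition
(`toComplexL2_add_I_smul_mem_orthogonalComplement`). This gives (i) ⇔ (ii); the rest is Hilbert
space duality. -/

open MeasureTheory

/-! ### Ranges of unbounded self-adjoint operators -/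

namespace LinearPMap

variable {𝕜 E : Type*} [RCLike 𝕜] [NormedAddCommGroup E] [InnerProductSpace 𝕜 E] [CompleteSpace E]

/-- An injective self-adjoint operator has dense range. -/
theorem denseRange_of_isSelfAdjoint {A : E →ₗ.[𝕜] E} (hA : IsSelfAdjoint A)
    (hker : LinearMap.ker A.toFun = ⊥) : DenseRange A.toFun := by
  have hd := hA.dense_domain
  have key : (LinearMap.range A.toFun)ᗮ = ⊥ := by
    rw [Submodule.eq_bot_iff]
    intro y hy
    -- Orthogonality to the range says that `y` lies in the domain of the adjoint, with value zero;
    -- by self-adjointness `y` is in the kernel of `A`.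
    have hy0 : ∀ x : A.domain, inner 𝕜 (0 : E) (x : E) = inner 𝕜 y (A x) := fun x => by
      rw [inner_zero_left]
      exact ((Submodule.mem_orthogonal' _ _).1 hy _ (LinearMap.mem_range_self _ x)).symm
    have hmem : y ∈ (adjoint A).domain := mem_adjoint_domain_of_exists y ⟨0, hy0⟩
    have hval : adjoint A ⟨y, hmem⟩ = 0 := adjoint_apply_eq hd _ hy0
    have hg : (y, (0 : E)) ∈ (adjoint A).graph := by
      rw [mem_graph_iff]
      exact ⟨⟨y, hmem⟩, rfl, hval⟩
    rw [isSelfAdjoint_def.1 hA, mem_graph_iff] at hg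
    obtain ⟨x, hx, hx0⟩ := hg
    have : x = 0 := LinearMap.ker_eq_bot'.1 hker x hx0
    simpa [this] using hx.symm
  have := (Submodule.topologicalClosure_eq_top_iff).2 key
  rw [← Submodule.dense_iff_topologicalClosure_eq_top] at this
  exact this

end LinearPMap

namespace OscillatorField

/-! ### Completed domains and the square root -/

section HilbertScale

variable {H : Type*} [NormedAddCommGroup H] [InnerProductSpace ℝ H]

theorem denseRange_toCompletedDomain (T : H →ₗ.[ℝ] H) : DenseRange (toCompletedDomain T) :=
  UniformSpace.Completion.denseRange_coe (α := NormedDomain T)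

theorem norm_toCompletedDomain (T : H →ₗ.[ℝ] H) (x : T.domain) :
    ‖toCompletedDomain T x‖ = ‖T x‖ :=
  UniformSpace.Completion.norm_coe (E := NormedDomain T) x

theorem mem_imageInCompletion {T : H →ₗ.[ℝ] H} {V : Submodule ℝ H} {η : CompletedDomain T} :
    η ∈ imageInCompletion T V ↔ ∃ x : T.domain, (x : H) ∈ V ∧ toCompletedDomain T x = η :=
  Iff.rfl

variable [CompleteSpace H]

theorem extendedApply_toCompletedDomain (T : H →ₗ.[ℝ] H) (x : T.domain) :
    extendedApply T (toCompletedDomain T x) = T x :=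
  LinearMap.extendOfNorm_eq (denseRange_toCompletedDomain T)
    ⟨1, fun x => by rw [one_mul, norm_toCompletedDomain]; rfl⟩ x

theorem norm_extendedApply (T : H →ₗ.[ℝ] H) (h : CompletedDomain T) :
    ‖extendedApply T h‖ = ‖h‖ := by
  refine (denseRange_toCompletedDomain T).induction_on
    (p := fun h => ‖extendedApply T h‖ = ‖h‖) h
    (isClosed_eq (extendedApply T).continuous.norm continuous_norm) fun x => ?_
  rw [extendedApply_toCompletedDomain, norm_toCompletedDomain]

theorem isometry_extendedApply (T : H →ₗ.[ℝ] H) : Isometry (extendedApply T) :=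
  AddMonoidHomClass.isometry_of_norm _ (norm_extendedApply T)

/-- An isometry from a complete space has closed range, and this range contains that of `T`. -/
theorem extendedApply_surjective {T : H →ₗ.[ℝ] H} (hT : DenseRange T.toFun) :
    Function.Surjective (extendedApply T) := by
  have hcl := (isometry_extendedApply T).isClosedEmbedding.isClosed_range
  have hd : DenseRange (extendedApply T) := by
    refine hT.mono ?_
    rintro _ ⟨x, rfl⟩
    exact ⟨_, extendedApply_toCompletedDomain T x⟩
  rw [← Set.range_eq_univ, ← hcl.closure_eq]
  exact hd.closure_range

theorem forall_mem_imageInCompletion {T : H →ₗ.[ℝ] H} {V : Submodule ℝ H} {v : H} :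
    (∀ η ∈ imageInCompletion T V, inner ℝ (extendedApply T η) v = 0) ↔
      ∀ x : T.domain, (x : H) ∈ V → inner ℝ (T x) v = 0 := by
  constructor
  · intro h x hx
    rw [← extendedApply_toCompletedDomain]
    exact h _ (mem_imageInCompletion.2 ⟨x, hx, rfl⟩)
  · intro h η hη
    obtain ⟨x, hx, rfl⟩ := mem_imageInCompletion.1 hη
    rw [extendedApply_toCompletedDomain]
    exact h x hx

/-- A positive square root of an injective operator is injective. -/
theorem IsPositiveSqrt.ker_eq_bot {R A : H →ₗ.[ℝ] H} (h : IsPositiveSqrt R A)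
    (hker : LinearMap.ker A.toFun = ⊥) : LinearMap.ker R.toFun = ⊥ := by
  rw [LinearMap.ker_eq_bot']
  intro x hx
  have hxA : ((x : H), (0 : H)) ∈ A.graph :=
    (h.sq_eq _ _).2 ⟨0, R.mem_graph_iff.2 ⟨x, rfl, hx⟩, R.graph.zero_mem⟩
  obtain ⟨y, hy, hy0⟩ := A.mem_graph_iff.1 hxA
  have : y = 0 := LinearMap.ker_eq_bot'.1 hker y hy0
  ext
  simpa [this] using hy.symm

theorem powHalf_spec {Ω : H →ₗ.[ℝ] H} (h : ∃ R, IsPositiveSqrt R Ω) :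
    IsPositiveSqrt (powHalf Ω) Ω := by
  rw [powHalf, dif_pos h]
  exact h.choose_spec

/-- On a trivial space every operator has a positive square root; hence `Ω` has one as soon as
the domain of `powHalf Ω` is dense. -/
theorem isPositiveSqrt_powHalf_of_dense {Ω : H →ₗ.[ℝ] H} (hΩ : IsPositiveSelfAdjoint Ω)
    (hd : Dense ((powHalf Ω).domain : Set H)) : IsPositiveSqrt (powHalf Ω) Ω := by
  refine powHalf_spec ?_
  by_contra hne
  -- Without a square root, `powHalf Ω` is the junk value with domain `{0}`, which is dense only in
  -- the trivial space; there `Ω` is its own root.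
  have hbot : (powHalf Ω).domain = ⊥ := by rw [powHalf, dif_neg hne]; rfl
  have hsub : Subsingleton H := by
    rw [hbot] at hd
    refine ⟨fun a b => ?_⟩
    have hx : ∀ x : H, x = 0 := fun x => by
      have := hd x
      rwa [Submodule.bot_coe, closure_singleton, Set.mem_singleton_iff] at this
    rw [hx a, hx b]
  refine hne ⟨Ω, hΩ, fun x y => ?_⟩
  have hall : ∀ z : H × H, z ∈ Ω.graph := fun z => by
    rw [Subsingleton.elim z 0]
    exact Ω.graph.zero_mem
  exact ⟨fun _ => ⟨0, hall _, hall _⟩, fun _ => hall _⟩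

theorem denseRange_powNegHalf {Ω : H →ₗ.[ℝ] H} (hΩ : IsPositiveSqrt (powHalf Ω) Ω)
    (hker : LinearMap.ker Ω.toFun = ⊥) : DenseRange (powNegHalf Ω).toFun := by
  have h := LinearPMap.inverse_range (hΩ.ker_eq_bot hker)
  have : Set.range (powNegHalf Ω).toFun = ((powHalf Ω).domain : Set H) := by
    rw [← h]; rfl
  rw [DenseRange, this]
  exact hΩ.positive.selfAdjoint.dense_domain

theorem extendedApply_powHalfToKNegHalf {Ω : H →ₗ.[ℝ] H}
    (hker : LinearMap.ker (powHalf Ω).toFun = ⊥) (x : (powHalf Ω).domain) :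
    extendedApply (powNegHalf Ω) (powHalfToKNegHalf Ω x) = x := by
  rw [powHalfToKNegHalf, LinearMap.comp_apply, extendedApply_toCompletedDomain]
  exact LinearPMap.inverse_apply_eq hker rfl

/-- `Ω^{-1/2} Ω h = Ω^{1/2} h` for `h ∈ 𝒦_{1/2}`. -/
theorem extendedApply_extendedOmega {Ω : H →ₗ.[ℝ] H}
    (hd : Dense ((powHalf Ω).domain : Set H))
    (hker : LinearMap.ker (powHalf Ω).toFun = ⊥) (h : KHalf Ω) :
    extendedApply (powNegHalf Ω) (extendedOmega Ω h) = extendedApply (powHalf Ω) h := by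
  rw [extendedOmega, ContinuousLinearMap.comp_apply]
  have hd' : DenseRange (powHalf Ω).domain.subtype := hd.denseRange_val
  refine hd'.induction_on (p := fun v => extendedApply (powNegHalf Ω)
    (LinearMap.extendOfNorm (powHalfToKNegHalf Ω) (powHalf Ω).domain.subtype v) = v) _
    (isClosed_eq ((extendedApply _).continuous.comp (ContinuousLinearMap.continuous _))
      continuous_id) fun x => ?_
  -- The bound holds with constant 1 because `Ω^{1/2} x` has norm `‖x‖` in `𝒦_{-1/2}`.
  rw [LinearMap.extendOfNorm_eq hd' ⟨1, fun x => ?_⟩, extendedApply_powHalfToKNegHalf hker]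
  · rfl
  · rw [one_mul, ← norm_extendedApply, extendedApply_powHalfToKNegHalf hker]
    rfl

end HilbertScale

/-! ### Real and imaginary parts in `L²` -/

section Complexification

variable {X : Type*} [MeasurableSpace X] {μ : Measure X}

theorem coeFn_toComplexL2 (f : Lp ℝ 2 μ) : toComplexL2 μ f =ᵐ[μ] fun x => (f x : ℂ) :=
  Complex.ofRealCLM.coeFn_compLpL f

theorem inner_toComplexL2 (f g : Lp ℝ 2 μ) :
    inner ℂ (toComplexL2 μ f) (toComplexL2 μ g) = (inner ℝ f g : ℝ) := by
  rw [L2.inner_def, L2.inner_def, ← integral_complex_ofReal]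
  refine integral_congr_ae ?_
  filter_upwards [coeFn_toComplexL2 f, coeFn_toComplexL2 g] with x hf hg
  rw [hf, hg]
  simp

theorem exists_toComplexL2_add_I_smul (u : Lp ℂ 2 μ) :
    ∃ a b : Lp ℝ 2 μ, u = toComplexL2 μ a + Complex.I • toComplexL2 μ b := by
  refine ⟨Complex.reCLM.compLpL 2 μ u, Complex.imCLM.compLpL 2 μ u, ?_⟩
  ext1
  filter_upwards [Lp.coeFn_add (toComplexL2 μ (Complex.reCLM.compLpL 2 μ u))
      (Complex.I • toComplexL2 μ (Complex.imCLM.compLpL 2 μ u)),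
    Lp.coeFn_smul Complex.I (toComplexL2 μ (Complex.imCLM.compLpL 2 μ u)),
    coeFn_toComplexL2 (Complex.reCLM.compLpL 2 μ u),
    coeFn_toComplexL2 (Complex.imCLM.compLpL 2 μ u),
    Complex.reCLM.coeFn_compLpL u, Complex.imCLM.coeFn_compLpL u] with x h1 h2 h3 h4 h5 h6
  rw [h1, Pi.add_apply, h2, Pi.smul_apply, h3, h4, h5, h6, smul_eq_mul, mul_comm]
  exact (Complex.re_add_im _).symm

theorem inner_toComplexL2_add_I_smul_eq_zero {f a b : Lp ℝ 2 μ} :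
    inner ℂ (toComplexL2 μ f) (toComplexL2 μ a + Complex.I • toComplexL2 μ b) = 0 ↔
      inner ℝ f a = 0 ∧ inner ℝ f b = 0 := by
  rw [inner_add_right, inner_smul_right, inner_toComplexL2, inner_toComplexL2, Complex.ext_iff]
  simp

theorem toComplexL2_eq_zero {f : Lp ℝ 2 μ} : toComplexL2 μ f = 0 ↔ f = 0 := by
  rw [← inner_self_eq_zero (𝕜 := ℂ), inner_toComplexL2, Complex.ofReal_eq_zero,
    inner_self_eq_zero]

end Complexification

/-! ### Orthogonal complements of sets -/

section OrthogonalComplement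

variable {V : Type*} [NormedAddCommGroup V] [InnerProductSpace ℂ V]

theorem mem_orthogonalComplement {M : Set V} {v : V} :
    v ∈ orthogonalComplement M ↔ ∀ w ∈ M, inner ℂ w v = 0 :=
  Iff.rfl

theorem orthogonalComplement_coe (M : Submodule ℂ V) :
    orthogonalComplement (M : Set V) = Mᗮ := by
  ext v
  rw [mem_orthogonalComplement, Submodule.mem_orthogonal]
  rfl

theorem orthogonalComplement_eq_span_orthogonal (M : Set V) :
    orthogonalComplement M = (Submodule.span ℂ M)ᗮ := by
  ext v
  rw [mem_orthogonalComplement, Submodule.mem_orthogonal]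
  refine ⟨fun h w hw => ?_, fun h w hw => h w (Submodule.subset_span hw)⟩
  induction hw using Submodule.span_induction with
  | mem w hw => exact h w hw
  | zero => exact inner_zero_left _
  | add x y _ _ hx hy => rw [inner_add_left, hx, hy, add_zero]
  | smul c x _ hx => rw [inner_smul_left, hx, mul_zero]

end OrthogonalComplement

/-! ### Reduction of both sides to one real orthogonality condition -/

section LocalStructure

variable {X : Type*} [MeasurableSpace X] {μ : Measure X}
  {Ω : Lp ℝ 2 μ →ₗ.[ℝ] Lp ℝ 2 μ} {S : Submodule ℝ (Lp ℝ 2 μ)}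

theorem IsLocalStructure.dense (hS : IsLocalStructure Ω S) : Dense (S : Set (Lp ℝ 2 μ)) := by
  have htop : L2On μ Set.univ = ⊤ :=
    eq_top_iff.2 fun f _ => show ∀ᵐ x ∂μ, x ∉ Set.univ → f x = 0 from
      Filter.Eventually.of_forall fun x hx => absurd (Set.mem_univ x) hx
  have h := hS.dense_localPart Set.univ MeasurableSet.univ
  rw [htop, ← Submodule.dense_iff_topologicalClosure_eq_top] at h
  exact h.mono fun f hf => hf.1

/-- Existence of the root needs no spectral theorem: the dense space `𝒮` lies in the domain of
`powHalf Ω`, which rules out the junk value unless the space is trivial. -/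
theorem IsLocalStructure.isPositiveSqrt_powHalf (hS : IsLocalStructure Ω S)
    (hΩ : IsPositiveSelfAdjoint Ω) : IsPositiveSqrt (powHalf Ω) Ω :=
  isPositiveSqrt_powHalf_of_dense hΩ (hS.dense.mono fun _ hf => (hS.le_domain hf).1)

variable (Ω S) in
/-- `v` is orthogonal to `Ω^{1/2} 𝒮_B` and to `Ω^{-1/2} 𝒮_B`. -/
def IsOrthogonalToLocal (B : Set X) (v : Lp ℝ 2 μ) : Prop :=
  (∀ p : (powNegHalf Ω).domain, (p : Lp ℝ 2 μ) ∈ localPart S B → inner ℝ (powNegHalf Ω p) v = 0) ∧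
    ∀ q : (powHalf Ω).domain, (q : Lp ℝ 2 μ) ∈ localPart S B → inner ℝ (powHalf Ω q) v = 0

theorem vanishesInHalf_iff {B : Set X} {h : KHalf Ω} :
    VanishesInHalf Ω S B h ↔ ∀ p : (powNegHalf Ω).domain, (p : Lp ℝ 2 μ) ∈ localPart S B →
      inner ℝ (powNegHalf Ω p) (extendedApply (powHalf Ω) h) = 0 := by
  rw [← forall_mem_imageInCompletion]
  simp only [VanishesInHalf, pairing, real_inner_comm]

theorem vanishesInNegHalf_iff {B : Set X} {h : KNegHalf Ω} :
    VanishesInNegHalf Ω S B h ↔ ∀ q : (powHalf Ω).domain, (q : Lp ℝ 2 μ) ∈ localPart S B →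
      inner ℝ (powHalf Ω q) (extendedApply (powNegHalf Ω) h) = 0 :=
  forall_mem_imageInCompletion

theorem stronglyNonlocal_iff (hΩ : IsPositiveSqrt (powHalf Ω) Ω)
    (hker : LinearMap.ker Ω.toFun = ⊥) {B : Set X} :
    StronglyNonlocal Ω S B ↔ ∀ v, IsOrthogonalToLocal Ω S Bᶜ v → v = 0 := by
  have hkerR := hΩ.ker_eq_bot hker
  have hsurj : Function.Surjective (extendedApply (powHalf Ω)) :=
    extendedApply_surjective (LinearPMap.denseRange_of_isSelfAdjoint hΩ.positive.selfAdjoint hkerR)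
  have hvan : ∀ h : KHalf Ω, IsOrthogonalToLocal Ω S Bᶜ (extendedApply (powHalf Ω) h) ↔
      VanishesInHalf Ω S Bᶜ h ∧ VanishesInNegHalf Ω S Bᶜ (extendedOmega Ω h) := fun h => by
    rw [vanishesInHalf_iff, vanishesInNegHalf_iff,
      extendedApply_extendedOmega hΩ.positive.selfAdjoint.dense_domain hkerR, IsOrthogonalToLocal]
  have hzero : ∀ h : KHalf Ω, extendedApply (powHalf Ω) h = 0 ↔ h = 0 := fun h => by
    rw [← norm_eq_zero, norm_extendedApply, norm_eq_zero]
  -- By surjectivity every `v` is some `Ω^{1/2} h`.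
  rw [hsurj.forall]
  simp only [StronglyNonlocal, hvan, hzero]
  push Not
  exact ⟨fun H h hh => by_contra fun hne => H h hne hh.1 hh.2,
    fun H h hne h1 h2 => hne (H h ⟨h1, h2⟩)⟩

/-- Testing with `q = 0` or `p = 0` separates the two conditions, and the nonzero factor `1/√2`
drops out. -/
theorem mem_orthogonalComplement_zMap_image {B : Set X} {u : Lp ℂ 2 μ} :
    u ∈ orthogonalComplement (zMap Ω '' (localPhaseSpace Ω S B : Set (PhaseSpace Ω))) ↔
      (∀ p : (powNegHalf Ω).domain, (p : Lp ℝ 2 μ) ∈ localPart S B →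
        inner ℂ (toComplexL2 μ (powNegHalf Ω p)) u = 0) ∧
      ∀ q : (powHalf Ω).domain, (q : Lp ℝ 2 μ) ∈ localPart S B →
        inner ℂ (toComplexL2 μ (powHalf Ω q)) u = 0 := by
  have hc : ((1 / Real.sqrt 2 : ℝ) : ℂ) ≠ 0 :=
    Complex.ofReal_ne_zero.2 (one_div_ne_zero (Real.sqrt_ne_zero'.2 two_pos))
  have hz : ∀ Y : PhaseSpace Ω, inner ℂ (zMap Ω Y) u = 0 ↔
      inner ℂ (toComplexL2 μ (extendedApply (powHalf Ω) Y.1)) u +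
        (starRingEnd ℂ) Complex.I *
          inner ℂ (toComplexL2 μ (extendedApply (powNegHalf Ω) Y.2)) u = 0 := fun Y => by
    rw [zMap, inner_smul_left, mul_eq_zero, inner_add_left, inner_smul_left,
      or_iff_right ((map_ne_zero _).2 hc)]
  rw [mem_orthogonalComplement, Set.forall_mem_image]
  simp only [hz]
  constructor
  · intro H
    refine ⟨fun p hp => ?_, fun q hq => ?_⟩
    · have := H (x := (0, toCompletedDomain _ p))
        ⟨Submodule.zero_mem _, mem_imageInCompletion.2 ⟨p, hp, rfl⟩⟩
      simpa [extendedApply_toCompletedDomain] using this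
    · have := H (x := (toCompletedDomain _ q, 0))
        ⟨mem_imageInCompletion.2 ⟨q, hq, rfl⟩, Submodule.zero_mem _⟩
      simpa [extendedApply_toCompletedDomain] using this
  · rintro ⟨Hp, Hq⟩ ⟨_, _⟩ ⟨⟨q, hq, rfl⟩, ⟨p, hp, rfl⟩⟩
    dsimp only
    rw [extendedApply_toCompletedDomain, extendedApply_toCompletedDomain, Hp p hp, Hq q hq,
      mul_zero, add_zero]

theorem toComplexL2_add_I_smul_mem_orthogonalComplement {B : Set X} {a b : Lp ℝ 2 μ} :
    toComplexL2 μ a + Complex.I • toComplexL2 μ b ∈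
        orthogonalComplement (zMap Ω '' (localPhaseSpace Ω S B : Set (PhaseSpace Ω))) ↔
      IsOrthogonalToLocal Ω S B a ∧ IsOrthogonalToLocal Ω S B b := by
  rw [mem_orthogonalComplement_zMap_image]
  simp only [inner_toComplexL2_add_I_smul_eq_zero, IsOrthogonalToLocal]
  exact ⟨fun ⟨hp, hq⟩ => ⟨⟨fun p h => (hp p h).1, fun q h => (hq q h).1⟩,
      fun p h => (hp p h).2, fun q h => (hq q h).2⟩,
    fun ⟨ha, hb⟩ => ⟨fun p h => ⟨ha.1 p h, hb.1 p h⟩, fun q h => ⟨ha.2 q h, hb.2 q h⟩⟩⟩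

theorem orthogonalComplement_zMap_image_eq_bot_iff {B : Set X} :
    orthogonalComplement (zMap Ω '' (localPhaseSpace Ω S B : Set (PhaseSpace Ω))) = ⊥ ↔
      ∀ v, IsOrthogonalToLocal Ω S B v → v = 0 := by
  rw [Submodule.eq_bot_iff]
  constructor
  · intro H v hv
    -- A real `v` is tested as the complex vector `v + i 0`.
    have hmem := toComplexL2_add_I_smul_mem_orthogonalComplement.2
      ⟨hv, show IsOrthogonalToLocal Ω S B 0 from
        ⟨fun _ _ => inner_zero_right _, fun _ _ => inner_zero_right _⟩⟩
    have := H _ hmem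
    rwa [map_zero, smul_zero, add_zero, toComplexL2_eq_zero] at this
  · intro H u hu
    obtain ⟨a, b, rfl⟩ := exists_toComplexL2_add_I_smul u
    obtain ⟨ha, hb⟩ := toComplexL2_add_I_smul_mem_orthogonalComplement.1 hu
    rw [H a ha, H b hb, map_zero, smul_zero, add_zero]

end LocalStructure

end OscillatorField


/-! ### The equivalences -/

theorem mainTheorem3 {K : Type*} [TopologicalSpace K] [MeasurableSpace K] [BorelSpace K]
    (μ : MeasureTheory.Measure K)
    (Ω : MeasureTheory.Lp ℝ 2 μ →ₗ.[ℝ] MeasureTheory.Lp ℝ 2 μ)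
    (hΩ : OscillatorField.IsPositiveSelfAdjoint Ω)
    (hker : LinearMap.ker Ω.toFun = ⊥)
    (S : Submodule ℝ (MeasureTheory.Lp ℝ 2 μ))
    (hS : OscillatorField.IsLocalStructure Ω S)
    (B : Set K) :
    List.TFAE
      [OscillatorField.StronglyNonlocal Ω S B,
       OscillatorField.orthogonalComplement
        (OscillatorField.zMap Ω '' (OscillatorField.localPhaseSpace Ω S Bᶜ : Set _)) = ⊥,
       OscillatorField.orthogonalComplement
        (((Submodule.span ℂ (OscillatorField.zMap Ω ''
            (OscillatorField.localPhaseSpace Ω S Bᶜ : Set _))).topologicalClosure :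
          Submodule ℂ (MeasureTheory.Lp ℂ 2 μ)) : Set (MeasureTheory.Lp ℂ 2 μ)) = ⊥,
       Dense ((Submodule.span ℂ (OscillatorField.zMap Ω ''
            (OscillatorField.localPhaseSpace Ω S Bᶜ : Set _)) :
          Submodule ℂ (MeasureTheory.Lp ℂ 2 μ)) : Set (MeasureTheory.Lp ℂ 2 μ))] := by
  have hsqrt := hS.isPositiveSqrt_powHalf hΩ
  tfae_have 1 ↔ 2 := by
    rw [OscillatorField.stronglyNonlocal_iff hsqrt hker,
      OscillatorField.orthogonalComplement_zMap_image_eq_bot_iff]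
  tfae_have 2 ↔ 3 := by
    rw [OscillatorField.orthogonalComplement_coe, Submodule.orthogonal_closure,
      OscillatorField.orthogonalComplement_eq_span_orthogonal]
  tfae_have 2 ↔ 4 := by
    rw [OscillatorField.orthogonalComplement_eq_span_orthogonal,
      Submodule.dense_iff_topologicalClosure_eq_top, Submodule.topologicalClosure_eq_top_iff]
  tfae_finish
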